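/- Let $g\ge 1$ be an integer and let $\ell\ge 3$ be a prime number. Let $\mathrm{Sp}(2g,\mathbb{F}_\ell)$ be the group of $2g\times 2g$ matrices over $\mathbb{F}_\ell$ that preserve the standard nondegenerate alternating form on $\mathbb{F}_\ell^{2g}$. An element $\tau\in\mathrm{Sp}(2g,\mathbb{F}_\ell)$ is called a transvection if $\tau\neq 1$ and there are a linear form $f$ on $\mathbb{F}_\ell^{2g}$ and a vector $v\in\mathbb{F}_\ell^{2g}$ with $f(v)=0$ such that $\tau(x)=x+f(x)v$ for all $x\in\mathbb{F}_\ell^{2g}$. If a subgroup $H$ of $\mathrm{Sp}(2g,\mathbb{F}_\ell)$ contains at least $\ell^{2g-1}$ transvections, then $H=\mathrm{Sp}(2g,\mathbb{F}_\ell)$. -/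

import Mathlib

/-- A square matrix over `K` is a (nontrivial) transvection if it is not the identity and acts on
column vectors as `x ↦ x + f x • v` for a linear form `f` and a vector `v` with `f v = 0`.
Mathlib's `LinearMap.transvection f v` is this map without the condition `f v = 0`, and it may be
the identity; both degenerate cases are excluded here. -/
def Matrix.IsNontrivialTransvection {n K : Type*} [Fintype n] [DecidableEq n] [Field K]
    (A : Matrix n n K) : Prop :=
  A ≠ 1 ∧ ∃ (f : Module.Dual K (n → K)) (v : n → K),
    f v = 0 ∧ Matrix.toLin' A = LinearMap.transvection f v

/-!
Let `B` be the symplectic form and `q` the order of the field. If `H` contains all transvections in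
the directions `v` and `w`, and `B v w ≠ 0`, then conjugating those in the direction `w` shows that
`H` contains all transvections in the direction `v + w`. So the set `S` of directions of
transvections of `H` is stable under nonzero scalars and under sums of non-orthogonal pairs, and the
lower bound on the number of transvections says that `S` fills at least `1 / q` of the space.

No proper subspace contains so dense a set, so `S` spans. Nor does the union of two independent
subspaces of dimension at least two; hence the graph of non-orthogonality on `S` is connected, since
otherwise a connected component and the rest of `S` would span two such subspaces. Paths of length
three in this graph can be shortened to paths of length two, and for `q ≥ 3` two elements of `S`
with a common neighbor have their sum in `S` unless it vanishes. Thus `S ∪ {0}` is a subspace, hence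
everything, so `H` contains all symplectic transvections, and these generate the symplectic group.
-/

open Module

section Counting

variable {F V : Type*} [Field F] [AddCommGroup V] [Module F V] [Finite F] [FiniteDimensional F V]

theorem natCard_mul_natCard_le_of_ne_top {W : Submodule F V} (hW : W ≠ ⊤) :
    Nat.card F * Nat.card W ≤ Nat.card V := by
  rw [natCard_eq_pow_finrank (K := F) (V := W), natCard_eq_pow_finrank (K := F) (V := V),
    ← pow_succ']
  exact Nat.pow_le_pow_right Nat.card_pos (Submodule.finrank_lt hW)

theorem span_eq_top_of_natCard_le_mul_ncard {S : Set V} (h0 : (0 : V) ∉ S)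
    (hS : Nat.card V ≤ Nat.card F * S.ncard) : Submodule.span F S = ⊤ := by
  have : Finite V := Module.finite_of_finite F
  by_contra hspan
  have hlt : S.ncard < Nat.card (Submodule.span F S) :=
    Set.ncard_lt_ncard ⟨Submodule.subset_span, fun h => h0 (h (zero_mem _))⟩
  exact (hS.trans_lt (Nat.mul_lt_mul_of_pos_left hlt Nat.card_pos)).not_ge
    (natCard_mul_natCard_le_of_ne_top hspan)

theorem natCard_mul_ncard_lt_of_subset_union {W W' : Submodule F V} (hWW' : Disjoint W W')
    (hW : 2 ≤ finrank F W) (hW' : 2 ≤ finrank F W') {S : Set V} (h0 : (0 : V) ∉ S)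
    (hS : S ⊆ W ∪ W') : Nat.card F * S.ncard < Nat.card V := by
  have : Finite V := Module.finite_of_finite F
  have hq : 2 ≤ Nat.card F := Finite.one_lt_card
  have hlt : S.ncard < Nat.card W + Nat.card W' :=
    (Set.ncard_lt_ncard ⟨hS, fun h => h0 (h (.inl (zero_mem W)))⟩).trans_le
      (Set.ncard_union_le _ _)
  have hprod : Nat.card W * Nat.card W' ≤ Nat.card V := by
    rw [natCard_eq_pow_finrank (K := F) (V := W), natCard_eq_pow_finrank (K := F) (V := W'),
      natCard_eq_pow_finrank (K := F) (V := V), ← pow_add]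
    exact Nat.pow_le_pow_right Nat.card_pos (Submodule.finrank_add_finrank_le_of_disjoint hWW')
  have hsq {U : Submodule F V} (hU : 2 ≤ finrank F U) : Nat.card F ^ 2 ≤ Nat.card U := by
    rw [natCard_eq_pow_finrank (K := F) (V := U)]
    exact Nat.pow_le_pow_right Nat.card_pos hU
  have ha := Nat.mul_le_mul_right (Nat.card W') (hsq hW)
  have hb := Nat.mul_le_mul_left (Nat.card W) (hsq hW')
  have hqq : 2 * Nat.card F ≤ Nat.card F ^ 2 := by rw [sq]; exact Nat.mul_le_mul_right _ hq
  nlinarith [Nat.mul_le_mul_right (Nat.card W + Nat.card W') hqq]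

end Counting

section AlternatingForm

variable {F V : Type*} [Field F] [AddCommGroup V] [Module F V] {B : V →ₗ[F] V →ₗ[F] F}

theorem two_le_finrank_of_isAlt [FiniteDimensional F V] (hB : B.IsAlt) {W : Submodule F V}
    {v w : V} (hv : v ∈ W) (hw : w ∈ W) (hvw : B v w ≠ 0) : 2 ≤ finrank F W := by
  have hli : LinearIndependent F ![(⟨v, hv⟩ : W), ⟨w, hw⟩] := by
    refine LinearIndependent.pair_iff.mpr fun a b hab => ?_
    replace hab : a • v + b • w = 0 := congrArg Subtype.val hab
    have ha : a * B v w = 0 := by simpa [hB w] using congrArg (B · w) hab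
    have hb : b * B v w = 0 := by simpa [hB v] using congrArg (B v) hab
    exact ⟨(mul_eq_zero_iff_right hvw).mp ha, (mul_eq_zero_iff_right hvw).mp hb⟩
  simpa using hli.fintype_card_le_finrank

/-- The property of a set of vectors that it is stable under nonzero scalars and under sums of
pairs that are non-orthogonal for `B`, hence span a hyperbolic plane when `B` is alternating. The
directions of the transvection subgroups inside a subgroup of the symplectic group form such a
set. -/
structure IsHyperbolicallyClosed (B : V →ₗ[F] V →ₗ[F] F) (S : Set V) : Prop where
  zero_notMem : (0 : V) ∉ S
  smul_mem : ∀ ⦃c : F⦄, c ≠ 0 → ∀ ⦃v⦄, v ∈ S → c • v ∈ S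
  add_mem : ∀ ⦃v⦄, v ∈ S → ∀ ⦃w⦄, w ∈ S → B v w ≠ 0 → v + w ∈ S

/-- Two vectors have a common neighbor in `S` when some element of `S` is orthogonal to neither:
this is adjacency to a common vertex in the graph of non-orthogonality. -/
def HaveCommonNeighbor (B : V →ₗ[F] V →ₗ[F] F) (S : Set V) (v w : V) : Prop :=
  ∃ z ∈ S, B v z ≠ 0 ∧ B w z ≠ 0

theorem HaveCommonNeighbor.symm {S : Set V} {v w : V} :
    HaveCommonNeighbor B S v w → HaveCommonNeighbor B S w v :=
  fun ⟨z, hz, hvz, hwz⟩ => ⟨z, hz, hwz, hvz⟩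

theorem exists_mem_apply_ne_zero_of_span_eq_top (hB : B.SeparatingLeft) {S : Set V}
    (hS : Submodule.span F S = ⊤) {x : V} (hx : x ≠ 0) : ∃ s ∈ S, B x s ≠ 0 := by
  by_contra! h
  have hspan : Submodule.span F S ≤ LinearMap.ker (B x) := Submodule.span_le.mpr h
  exact hx (hB x fun y => hspan (hS ▸ Submodule.mem_top))

theorem disjoint_span_of_isOrtho (hB : B.IsRefl) (hnd : B.SeparatingLeft) {C D : Set V}
    (hspan : Submodule.span F (C ∪ D) = ⊤) (hCD : ∀ x ∈ C, ∀ y ∈ D, B x y = 0) :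
    Disjoint (Submodule.span F C) (Submodule.span F D) := by
  have hortho {x y : V} (hx : x ∈ Submodule.span F C) (hy : y ∈ Submodule.span F D) :
      B x y = 0 :=
    LinearMap.BilinMap.apply_apply_mem_of_mem_span ⊥ C D B hCD x y hx hy
  refine Submodule.disjoint_def.mpr fun x hxC hxD => ?_
  by_contra hx
  obtain ⟨s, hs | hs, hxs⟩ := exists_mem_apply_ne_zero_of_span_eq_top hnd hspan hx
  · exact hxs (hB.eq_zero (hortho (Submodule.subset_span hs) hxD))
  · exact hxs (hortho hxC (Submodule.subset_span hs))

namespace IsHyperbolicallyClosed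

variable {S : Set V}

theorem add_smul_mem (hS : IsHyperbolicallyClosed B S) {v w : V} (hv : v ∈ S) (hw : w ∈ S)
    (hvw : B v w ≠ 0) (a : F) : v + a • w ∈ S := by
  rcases eq_or_ne a 0 with rfl | ha
  · simpa using hv
  · exact hS.add_mem hv (hS.smul_mem ha hw) (by simp [ha, hvw])

theorem haveCommonNeighbor_of_apply_ne_zero (hS : IsHyperbolicallyClosed B S) (hB : B.IsAlt)
    {v w : V} (hv : v ∈ S) (hw : w ∈ S) (hvw : B v w ≠ 0) : HaveCommonNeighbor B S v w :=
  ⟨v + w, hS.add_mem hv hw hvw, by simpa [hB v], by simpa [hB w, hB.eq_iff (x := w)]⟩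

theorem haveCommonNeighbor_of_path (hS : IsHyperbolicallyClosed B S) {v a b w : V}
    (ha : a ∈ S) (hb : b ∈ S) (hva : B v a ≠ 0) (hab : B a b ≠ 0) (hwb : B w b ≠ 0) :
    HaveCommonNeighbor B S v w := by
  by_cases hvb : B v b = 0
  · by_cases hwa : B w a = 0
    · exact ⟨a + b, hS.add_mem ha hb hab, by simpa [hvb], by simpa [hwa]⟩
    · exact ⟨a, ha, hva, hwa⟩
  · exact ⟨b, hb, hvb, hwb⟩

theorem haveCommonNeighbor_trans (hS : IsHyperbolicallyClosed B S) (hB : B.IsAlt) {u v w : V}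
    (hv : v ∈ S) (huv : HaveCommonNeighbor B S u v) (hvw : HaveCommonNeighbor B S v w) :
    HaveCommonNeighbor B S u w := by
  obtain ⟨a, ha, hua, hva⟩ := huv
  obtain ⟨b, hb, hvb, hwb⟩ := hvw
  obtain ⟨z, hz, haz, hwz⟩ :=
    hS.haveCommonNeighbor_of_path hv hb (mt hB.eq_iff.mpr hva) hvb hwb
  exact hS.haveCommonNeighbor_of_path ha hz hua haz hwz

theorem add_mem_of_common_neighbor (hS : IsHyperbolicallyClosed B S) (hB : B.IsAlt) {v w z : V}
    (hv : v ∈ S) (hw : w ∈ S) (hz : z ∈ S) (hvz : B v z ≠ 0) (hwz : B w z ≠ 0)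
    (hvwz : B (v + w) z ≠ 0) : v + w ∈ S := by
  by_cases hvw : B v w = 0
  · have h₁ : v + z ∈ S := hS.add_mem hv hz hvz
    have h₂ : v + z + w ∈ S :=
      hS.add_mem h₁ hw (by simpa [hvw, hB.eq_iff (x := z)])
    have h₃ : v + z + w + (-1 : F) • z ∈ S :=
      hS.add_smul_mem h₂ hz (by simpa [hB z] using hvwz) (-1)
    convert h₃ using 1
    module
  · exact hS.add_mem hv hw hvw

theorem exists_mem_apply_ne_zero_of_haveCommonNeighbor (hS : IsHyperbolicallyClosed B S)
    (hB : B.IsAlt) (hF : 3 ≤ ENat.card F) {v w z : V} (hw : w ∈ S) (hz : z ∈ S)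
    (hvw : HaveCommonNeighbor B S v w) (hvz : B v z = 0) (hwz : B w z ≠ 0) :
    ∃ y ∈ S, B v y ≠ 0 ∧ B w y ≠ 0 ∧ B (v + w) y ≠ 0 := by
  obtain ⟨a, ha, hva, hwa⟩ := hvw
  obtain ⟨y, hy, hvy, hzy⟩ := hS.haveCommonNeighbor_of_path ha hw hva
    (mt hB.eq_iff.mpr hwa) (mt hB.eq_iff.mpr hwz)
  obtain ⟨b, hb₁, hb₂⟩ := ENat.exists_ne_ne_of_three_le hF
    (-B w y / B w z) (-(B v y + B w y) / B w z)
  rw [ne_eq, eq_div_iff hwz, eq_neg_iff_add_eq_zero, add_comm] at hb₁ hb₂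
  refine ⟨y + b • z, hS.add_smul_mem hy hz (mt hB.eq_iff.mpr hzy) b, ?_, ?_, ?_⟩
  · simpa [hvz] using hvy
  · simpa using hb₁
  · simpa [hvz, add_assoc] using hb₂

theorem add_mem_of_haveCommonNeighbor (hS : IsHyperbolicallyClosed B S) (hB : B.IsAlt)
    (hF : 3 ≤ ENat.card F) {v w z : V} (hv : v ∈ S) (hw : w ∈ S) (hz : z ∈ S)
    (hvw : HaveCommonNeighbor B S v w) (hvwz : B (v + w) z ≠ 0) : v + w ∈ S := by
  by_cases hvz : B v z = 0
  · obtain ⟨y, hy, hvy, hwy, hvwy⟩ := hS.exists_mem_apply_ne_zero_of_haveCommonNeighbor hB hF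
      hw hz hvw hvz (by simpa [hvz] using hvwz)
    exact hS.add_mem_of_common_neighbor hB hv hw hy hvy hwy hvwy
  by_cases hwz : B w z = 0
  · obtain ⟨y, hy, hwy, hvy, hwvy⟩ := hS.exists_mem_apply_ne_zero_of_haveCommonNeighbor hB hF
      hv hz hvw.symm hwz hvz
    exact hS.add_mem_of_common_neighbor hB hv hw hy hvy hwy (add_comm v w ▸ hwvy)
  exact hS.add_mem_of_common_neighbor hB hv hw hz hvz hwz hvwz

theorem eq_compl_zero_of_forall_haveCommonNeighbor (hS : IsHyperbolicallyClosed B S)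
    (hB : B.IsAlt) (hnd : B.SeparatingLeft) (hF : 3 ≤ ENat.card F)
    (hspan : Submodule.span F S = ⊤) (hconn : ∀ v ∈ S, ∀ w ∈ S, HaveCommonNeighbor B S v w) :
    S = {0}ᶜ := by
  refine Set.Subset.antisymm (fun v hv h0 => hS.zero_notMem (h0 ▸ hv)) fun x hx => ?_
  have hx_span : x ∈ Submodule.span F S := hspan ▸ Submodule.mem_top
  replace hx : x ≠ 0 := hx
  induction hx_span using Submodule.span_induction with
  | mem x hxS => exact hxS
  | zero => exact absurd rfl hx
  | add x y _ _ ihx ihy =>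
    rcases eq_or_ne x 0 with rfl | hx0
    · simpa using ihy (by simpa using hx)
    rcases eq_or_ne y 0 with rfl | hy0
    · simpa using ihx hx0
    obtain ⟨z, hz, hxyz⟩ := exists_mem_apply_ne_zero_of_span_eq_top hnd hspan hx
    exact hS.add_mem_of_haveCommonNeighbor hB hF (ihx hx0) (ihy hy0) hz
      (hconn _ (ihx hx0) _ (ihy hy0)) hxyz
  | smul c x _ ih =>
    exact hS.smul_mem (left_ne_zero_of_smul hx) (ih (right_ne_zero_of_smul hx))

theorem apply_eq_zero_of_not_haveCommonNeighbor (hS : IsHyperbolicallyClosed B S)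
    (hB : B.IsAlt) {v x y : V} (hx : x ∈ S) (hy : y ∈ S) (hvx : HaveCommonNeighbor B S v x)
    (hvy : ¬ HaveCommonNeighbor B S v y) : B x y = 0 := by
  by_contra hxy
  exact hvy (hS.haveCommonNeighbor_trans hB hx hvx
    (hS.haveCommonNeighbor_of_apply_ne_zero hB hx hy hxy))

theorem haveCommonNeighbor_of_natCard_le [Finite F] [FiniteDimensional F V]
    (hS : IsHyperbolicallyClosed B S) (hB : B.IsAlt) (hnd : B.SeparatingLeft)
    (hcard : Nat.card V ≤ Nat.card F * S.ncard) {v w : V} (hv : v ∈ S) (hw : w ∈ S) :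
    HaveCommonNeighbor B S v w := by
  by_contra hvw
  have hspan := span_eq_top_of_natCard_le_mul_ncard hS.zero_notMem hcard
  have hneighbor {u : V} (hu : u ∈ S) : ∃ s ∈ S, B u s ≠ 0 :=
    exists_mem_apply_ne_zero_of_span_eq_top hnd hspan (ne_of_mem_of_not_mem hu hS.zero_notMem)
  let N : Set V := {u | HaveCommonNeighbor B S v u}
  have hSN : S ∩ N ∪ S \ N = S := Set.inter_union_sdiff S N
  have hdisj : Disjoint (Submodule.span F (S ∩ N)) (Submodule.span F (S \ N)) :=
    disjoint_span_of_isOrtho hB.isRefl hnd (hSN.symm ▸ hspan) fun x hx y hy =>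
      hS.apply_eq_zero_of_not_haveCommonNeighbor hB hx.1 hy.1 hx.2 hy.2
  have hC : 2 ≤ finrank F (Submodule.span F (S ∩ N)) := by
    obtain ⟨s, hs, hvs⟩ := hneighbor hv
    refine two_le_finrank_of_isAlt hB (Submodule.subset_span ⟨hv, s, hs, hvs, hvs⟩)
      (Submodule.subset_span ⟨hs, ?_⟩) hvs
    exact hS.haveCommonNeighbor_of_apply_ne_zero hB hv hs hvs
  have hD : 2 ≤ finrank F (Submodule.span F (S \ N)) := by
    obtain ⟨s, hs, hws⟩ := hneighbor hw
    refine two_le_finrank_of_isAlt hB (Submodule.subset_span ⟨hw, hvw⟩)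
      (Submodule.subset_span ⟨hs, fun hvs => hvw ?_⟩) hws
    exact hS.haveCommonNeighbor_trans hB hs hvs
      (hS.haveCommonNeighbor_of_apply_ne_zero hB hw hs hws).symm
  exact (natCard_mul_ncard_lt_of_subset_union hdisj hC hD hS.zero_notMem
    (hSN.symm.subset.trans
      (Set.union_subset_union Submodule.subset_span Submodule.subset_span))).not_ge hcard

theorem eq_compl_zero_of_natCard_le [Finite F] [FiniteDimensional F V]
    (hS : IsHyperbolicallyClosed B S) (hB : B.IsAlt) (hnd : B.SeparatingLeft)
    (hF : 3 ≤ Nat.card F) (hcard : Nat.card V ≤ Nat.card F * S.ncard) : S = {0}ᶜ :=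
  hS.eq_compl_zero_of_forall_haveCommonNeighbor hB hnd
    (by rw [ENat.card_eq_coe_natCard]; exact_mod_cast hF)
    (span_eq_top_of_natCard_le_mul_ncard hS.zero_notMem hcard)
    fun _ hv _ hw => hS.haveCommonNeighbor_of_natCard_le hB hnd hcard hv hw

end IsHyperbolicallyClosed

end AlternatingForm

section SymplecticGroup

open Matrix

variable {l F : Type*} [DecidableEq l] [Fintype l] [Field F]

variable (l F) in
/-- The standard symplectic form on `F ^ (l ⊕ l)`, with Gram matrix `Matrix.J l F`. -/
noncomputable def symplecticForm : (l ⊕ l → F) →ₗ[F] (l ⊕ l → F) →ₗ[F] F :=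
  toLinearMap₂' F (J l F)

theorem symplecticForm_apply (v w : l ⊕ l → F) : symplecticForm l F v w = v ⬝ᵥ J l F *ᵥ w :=
  toLinearMap₂'_apply' _ _ _

theorem symplecticForm_isAlt : (symplecticForm l F).IsAlt := fun v => by
  rw [symplecticForm_apply, J, fromBlocks_mulVec]
  simp [dotProduct, Fintype.sum_sum_type, neg_mulVec, mul_comm]

theorem symplecticForm_separatingLeft : (symplecticForm l F).SeparatingLeft :=
  LinearMap.separatingLeft_toLinearMap₂'_of_det_ne_zero' (isUnit_det_J l F).ne_zero

theorem mem_symplecticGroup_iff_isOrthogonal {A : Matrix (l ⊕ l) (l ⊕ l) F} :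
    A ∈ symplecticGroup l F ↔ (symplecticForm l F).IsOrthogonal (A *ᵥ ·) := by
  rw [SymplecticGroup.mem_iff', ← (toLinearMap₂' (S₁ := F) (S₂ := F) F).injective.eq_iff,
    ← toLinearMap₂'_comp, LinearMap.ext_iff₂]
  rfl

theorem symplecticForm_mulVec (A : symplecticGroup l F) (v w : l ⊕ l → F) :
    symplecticForm l F (A.1 *ᵥ v) (A.1 *ᵥ w) = symplecticForm l F v w :=
  mem_symplecticGroup_iff_isOrthogonal.mp A.2 v w

theorem symplecticGroup_ext_mulVec {A B : symplecticGroup l F} (h : ∀ v, A.1 *ᵥ v = B.1 *ᵥ v) :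
    A = B :=
  Subtype.ext (ext_of_mulVec_single fun _ => h _)

theorem one_add_smul_vecMulVec_mulVec (v x : l ⊕ l → F) (a : F) :
    (1 + a • vecMulVec v (v ᵥ* J l F)) *ᵥ x = x + (a * symplecticForm l F v x) • v := by
  rw [add_mulVec, one_mulVec, smul_mulVec, vecMulVec_mulVec, ← dotProduct_mulVec,
    ← symplecticForm_apply, op_smul_eq_smul, smul_smul]

/-- The symplectic transvection `x ↦ x + a B(v, x) v`, where `B` is the standard symplectic form. It
is the identity when `v = 0` or `a = 0`. -/
def symplecticTransvection (v : l ⊕ l → F) (a : F) : symplecticGroup l F :=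
  ⟨1 + a • vecMulVec v (v ᵥ* J l F), mem_symplecticGroup_iff_isOrthogonal.mpr fun x y => by
    simp only [one_add_smul_vecMulVec_mulVec, map_add, map_smul, LinearMap.add_apply,
      LinearMap.smul_apply, smul_eq_mul, symplecticForm_isAlt v, ← symplecticForm_isAlt.neg x v]
    ring⟩

theorem symplecticTransvection_mulVec (v : l ⊕ l → F) (a : F) (x : l ⊕ l → F) :
    (symplecticTransvection v a).1 *ᵥ x = x + (a * symplecticForm l F v x) • v :=
  one_add_smul_vecMulVec_mulVec v x a

theorem symplecticTransvection_mulVec_eq_self {v x : l ⊕ l → F} (h : symplecticForm l F v x = 0)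
    (a : F) : (symplecticTransvection v a).1 *ᵥ x = x := by
  simp [symplecticTransvection_mulVec, h]

theorem symplecticTransvection_sub_mulVec {v w : l ⊕ l → F} (h : symplecticForm l F v w ≠ 0) :
    (symplecticTransvection (w - v) (symplecticForm l F v w)⁻¹).1 *ᵥ w = v := by
  simp [symplecticTransvection_mulVec, symplecticForm_isAlt w, h]

theorem symplecticTransvection_zero_left (a : F) :
    symplecticTransvection (0 : l ⊕ l → F) a = 1 :=
  symplecticGroup_ext_mulVec fun x => by simp [symplecticTransvection_mulVec]

theorem symplecticTransvection_zero_right (v : l ⊕ l → F) : symplecticTransvection v 0 = 1 :=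
  symplecticGroup_ext_mulVec fun x => by simp [symplecticTransvection_mulVec]

theorem symplecticTransvection_add (v : l ⊕ l → F) (a b : F) :
    symplecticTransvection v (a + b) = symplecticTransvection v a * symplecticTransvection v b := by
  refine symplecticGroup_ext_mulVec fun x => ?_
  simp only [Submonoid.coe_mul, ← mulVec_mulVec, symplecticTransvection_mulVec, map_add, map_smul,
    symplecticForm_isAlt v, smul_zero, add_zero]
  module

theorem symplecticTransvection_natCast_mul (v : l ⊕ l → F) (n : ℕ) (a : F) :
    symplecticTransvection v (n * a) = symplecticTransvection v a ^ n := by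
  induction n with
  | zero => simp [symplecticTransvection_zero_right]
  | succ n ih => rw [pow_succ, ← ih, ← symplecticTransvection_add, Nat.cast_succ, add_one_mul]

theorem symplecticTransvection_smul (c : F) (v : l ⊕ l → F) (a : F) :
    symplecticTransvection (c • v) a = symplecticTransvection v (c ^ 2 * a) :=
  symplecticGroup_ext_mulVec fun x => by
    simp only [symplecticTransvection_mulVec, map_smul, LinearMap.smul_apply, smul_eq_mul]
    module

theorem conj_symplecticTransvection (A : symplecticGroup l F) (v : l ⊕ l → F) (a : F) :
    A * symplecticTransvection v a * A⁻¹ = symplecticTransvection (A.1 *ᵥ v) a := by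
  rw [mul_inv_eq_iff_eq_mul]
  refine symplecticGroup_ext_mulVec fun x => ?_
  simp only [Submonoid.coe_mul, ← mulVec_mulVec, symplecticTransvection_mulVec,
    symplecticForm_mulVec, mulVec_add, mulVec_smul]

section Generation

variable {H : Subgroup (symplecticGroup l F)} {A : symplecticGroup l F}

theorem symplecticForm_mulVec_sub_eq_zero {x : l ⊕ l → F} (hx : A.1 *ᵥ x = x)
    (v : l ⊕ l → F) : symplecticForm l F (A.1 *ᵥ v - v) x = 0 := by
  have hAv := symplecticForm_mulVec A v x
  rw [hx] at hAv
  simp [hAv]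

theorem fixedSubmodule_lt_fixedSubmodule_mul {T : symplecticGroup l F} {v : l ⊕ l → F}
    (hv : A.1 *ᵥ v ≠ v) (hTv : T.1 *ᵥ (A.1 *ᵥ v) = v)
    (hT : ∀ x, A.1 *ᵥ x = x → T.1 *ᵥ x = x) :
    (toLin' A.1).fixedSubmodule < (toLin' (T * A).1).fixedSubmodule := by
  simp only [SetLike.lt_iff_le_and_exists, SetLike.le_def, LinearMap.mem_fixedSubmodule_iff,
    toLin'_apply, Submonoid.coe_mul, ← mulVec_mulVec]
  exact ⟨fun x hx => by rw [hx, hT x hx], v, hTv, hv⟩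

theorem exists_fixedSubmodule_lt_of_apply_ne_zero (hH : ∀ v a, symplecticTransvection v a ∈ H)
    {w : l ⊕ l → F} (hw : symplecticForm l F w (A.1 *ᵥ w) ≠ 0) :
    ∃ T ∈ H, (toLin' A.1).fixedSubmodule < (toLin' (T * A).1).fixedSubmodule := by
  refine ⟨_, hH (A.1 *ᵥ w - w) (symplecticForm l F w (A.1 *ᵥ w))⁻¹,
    fixedSubmodule_lt_fixedSubmodule_mul (v := w) (fun h => hw ?_)
      (symplecticTransvection_sub_mulVec hw) fun x hx =>
        symplecticTransvection_mulVec_eq_self (symplecticForm_mulVec_sub_eq_zero hx w) _⟩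
  rw [h, symplecticForm_isAlt w]

theorem exists_fixedSubmodule_lt_of_forall_apply_eq_zero
    (hH : ∀ v a, symplecticTransvection v a ∈ H)
    (hA : ∀ w, symplecticForm l F w (A.1 *ᵥ w) = 0) {v : l ⊕ l → F} (hv : A.1 *ᵥ v ≠ v) :
    ∃ T ∈ H, (toLin' A.1).fixedSubmodule < (toLin' (T * A).1).fixedSubmodule := by
  obtain ⟨u, hu⟩ : ∃ u, symplecticForm l F (A.1 *ᵥ v - v) u ≠ 0 := by
    by_contra! h
    exact hv (sub_eq_zero.mp (symplecticForm_separatingLeft _ h))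
  have hpolar : symplecticForm l F v (A.1 *ᵥ u) + symplecticForm l F u (A.1 *ᵥ v) = 0 := by
    simpa [mulVec_add, hA] using hA (v + u)
  have hneg_Av := symplecticForm_isAlt.neg u (A.1 *ᵥ v)
  have hneg_v := symplecticForm_isAlt.neg u v
  -- No single transvection takes `A v` to `v`, but two do, through `z`.
  let z := v + (A.1 *ᵥ u - u)
  have hvz : symplecticForm l F v z = symplecticForm l F (A.1 *ᵥ v - v) u := by
    simp only [z, map_add, map_sub, LinearMap.sub_apply, symplecticForm_isAlt v]
    linear_combination hpolar + hneg_Av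
  have hzAv : symplecticForm l F z (A.1 *ᵥ v) = symplecticForm l F (A.1 *ᵥ v - v) u := by
    simp only [z, map_add, map_sub, LinearMap.add_apply, LinearMap.sub_apply, hA,
      symplecticForm_mulVec]
    linear_combination hneg_Av - hneg_v
  refine ⟨_, mul_mem (hH (z - v) (symplecticForm l F v z)⁻¹)
    (hH (A.1 *ᵥ v - z) (symplecticForm l F z (A.1 *ᵥ v))⁻¹),
    fixedSubmodule_lt_fixedSubmodule_mul hv ?_ fun x hx => ?_⟩
  · rw [Submonoid.coe_mul, ← mulVec_mulVec, symplecticTransvection_sub_mulVec (hzAv ▸ hu),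
      symplecticTransvection_sub_mulVec (hvz ▸ hu)]
  · have hzv : symplecticForm l F (z - v) x = 0 := by
      simpa [z] using symplecticForm_mulVec_sub_eq_zero hx u
    have hAvz : symplecticForm l F (A.1 *ᵥ v - z) x = 0 := by
      rw [show A.1 *ᵥ v - z = (A.1 *ᵥ v - v) - (A.1 *ᵥ u - u) by simp only [z]; abel, map_sub,
        LinearMap.sub_apply, symplecticForm_mulVec_sub_eq_zero hx,
        symplecticForm_mulVec_sub_eq_zero hx, sub_zero]
    rw [Submonoid.coe_mul, ← mulVec_mulVec, symplecticTransvection_mulVec_eq_self hAvz,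
      symplecticTransvection_mulVec_eq_self hzv]

theorem eq_top_of_forall_symplecticTransvection_mem
    (hH : ∀ v a, symplecticTransvection v a ∈ H) : H = ⊤ := by
  refine (Subgroup.eq_top_iff' H).mpr fun A => ?_
  induction hW : (toLin' A.1).fixedSubmodule using WellFoundedGT.induction generalizing A with
  | ind W ih =>
    subst hW
    by_cases hA : ∀ v, A.1 *ᵥ v = v
    · rw [symplecticGroup_ext_mulVec (A := A) (B := 1) fun v => by simpa using hA v]
      exact one_mem H
    obtain ⟨v, hv⟩ := not_forall.mp hA
    obtain ⟨T, hT, hlt⟩ :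
        ∃ T ∈ H, (toLin' A.1).fixedSubmodule < (toLin' (T * A).1).fixedSubmodule := by
      by_cases hform : ∀ w, symplecticForm l F w (A.1 *ᵥ w) = 0
      · exact exists_fixedSubmodule_lt_of_forall_apply_eq_zero hH hform hv
      · obtain ⟨w, hw⟩ := not_forall.mp hform
        exact exists_fixedSubmodule_lt_of_apply_ne_zero hH hw
    exact (H.mul_mem_cancel_left hT).mp (ih _ hlt _ rfl)

end Generation

theorem exists_eq_symplecticTransvection {τ : symplecticGroup l F}
    (hτ : τ.1.IsNontrivialTransvection) :
    ∃ (v : l ⊕ l → F) (a : F), v ≠ 0 ∧ a ≠ 0 ∧ τ = symplecticTransvection v a := by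
  obtain ⟨hτ₁, f, v, -, hfv⟩ := hτ
  have hτx (x : l ⊕ l → F) : τ.1 *ᵥ x = x + f x • v := by
    rw [← toLin'_apply, hfv, LinearMap.transvection.apply]
  obtain ⟨y, hy⟩ : ∃ y, f y • v ≠ 0 := by
    by_contra! h
    refine hτ₁ (congrArg Subtype.val (symplecticGroup_ext_mulVec (A := τ) (B := 1) fun x => ?_))
    simp [hτx, h]
  have hv : v ≠ 0 := right_ne_zero_of_smul hy
  have hprop (x z : l ⊕ l → F) :
      f z * symplecticForm l F v x = f x * symplecticForm l F v z := by
    have hpres := symplecticForm_mulVec τ x z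
    simp only [hτx, map_add, map_smul, LinearMap.add_apply, LinearMap.smul_apply, smul_eq_mul,
      symplecticForm_isAlt v, ← symplecticForm_isAlt.neg v x] at hpres
    linear_combination -hpres
  obtain ⟨w, hw⟩ : ∃ w, symplecticForm l F v w ≠ 0 := by
    by_contra! h
    exact hv (symplecticForm_separatingLeft v h)
  have hfw : f w ≠ 0 := fun hfw => by
    simpa [hfw, hw, left_ne_zero_of_smul hy] using hprop w y
  refine ⟨v, f w / symplecticForm l F v w, hv, div_ne_zero hfw hw,
    symplecticGroup_ext_mulVec fun x => ?_⟩
  have hfx : f x = f w / symplecticForm l F v w * symplecticForm l F v x := by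
    rw [div_mul_eq_mul_div, eq_div_iff hw, hprop x w]
  rw [hτx, symplecticTransvection_mulVec, hfx]

section TransvectionDirections

/-- The directions of the full transvection subgroups inside `H`: the nonzero vectors `v` such that
`H` contains `x ↦ x + a B(v, x) v` for all `a`. -/
def transvectionDirections (H : Subgroup (symplecticGroup l F)) : Set (l ⊕ l → F) :=
  {v | v ≠ 0 ∧ ∀ a, symplecticTransvection v a ∈ H}

theorem isHyperbolicallyClosed_transvectionDirections (H : Subgroup (symplecticGroup l F)) :
    IsHyperbolicallyClosed (symplecticForm l F) (transvectionDirections H) where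
  zero_notMem h := h.1 rfl
  smul_mem c hc v hv :=
    ⟨smul_ne_zero hc hv.1, fun a => symplecticTransvection_smul c v a ▸ hv.2 _⟩
  add_mem v hv w hw hvw := by
    refine ⟨fun h => hvw ?_, fun a => ?_⟩
    · rw [eq_neg_of_add_eq_zero_right h, map_neg, symplecticForm_isAlt v, neg_zero]
    · have hadd : (symplecticTransvection v (symplecticForm l F v w)⁻¹).1 *ᵥ w = v + w := by
        rw [symplecticTransvection_mulVec, inv_mul_cancel₀ hvw, one_smul, add_comm]
      rw [← hadd, ← conj_symplecticTransvection]
      exact mul_mem (mul_mem (hv.2 _) (hw.2 a)) (inv_mem (hv.2 _))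

theorem symplecticTransvection_smul_inv_sq_mul {c : F} (hc : c ≠ 0) (v : l ⊕ l → F) (a : F) :
    symplecticTransvection (c • v) ((c ^ 2)⁻¹ * a) = symplecticTransvection v a := by
  rw [symplecticTransvection_smul, mul_inv_cancel_left₀ (pow_ne_zero 2 hc)]

theorem ncard_transvections_le_ncard_transvectionDirections [Finite F]
    {H : Subgroup (symplecticGroup l F)}
    (hfull : ∀ v a, a ≠ 0 → symplecticTransvection v a ∈ H → ∀ b, symplecticTransvection v b ∈ H) :
    {τ : symplecticGroup l F | τ ∈ H ∧ τ.1.IsNontrivialTransvection}.ncard ≤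
      (transvectionDirections H).ncard := by
  choose! v a hv ha hτ using fun τ => exists_eq_symplecticTransvection (l := l) (F := F) (τ := τ)
  -- Each transvection arises from exactly `q - 1` pairs `(v, a)`, as `v` ranges over a line.
  have hpairs : ({τ : symplecticGroup l F | τ ∈ H ∧ τ.1.IsNontrivialTransvection} ×ˢ
      ({0}ᶜ : Set F)).ncard ≤ (transvectionDirections H ×ˢ ({0}ᶜ : Set F)).ncard := by
    refine Set.ncard_le_ncard_of_injOn (fun x => (x.2 • v x.1, (x.2 ^ 2)⁻¹ * a x.1)) ?_ ?_
    · rintro ⟨τ, c⟩ ⟨⟨hτH, h⟩, hc : c ≠ 0⟩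
      have hdir : v τ ∈ transvectionDirections H :=
        ⟨hv τ h, hfull _ _ (ha τ h) (hτ τ h ▸ hτH)⟩
      exact ⟨(isHyperbolicallyClosed_transvectionDirections H).smul_mem hc hdir,
        mul_ne_zero (inv_ne_zero (pow_ne_zero 2 hc)) (ha τ h)⟩
    · rintro ⟨τ, c⟩ ⟨⟨-, h⟩, hc : c ≠ 0⟩ ⟨σ, d⟩ ⟨⟨-, h'⟩, hd : d ≠ 0⟩ heq
      obtain ⟨hdir, hcoeff⟩ : c • v τ = d • v σ ∧ (c ^ 2)⁻¹ * a τ = (d ^ 2)⁻¹ * a σ :=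
        Prod.mk.inj heq
      obtain rfl : τ = σ := by
        refine (hτ τ h).trans (.trans ?_ (hτ σ h').symm)
        rw [← symplecticTransvection_smul_inv_sq_mul hc, hdir, hcoeff,
          symplecticTransvection_smul_inv_sq_mul hd]
      exact congrArg (τ, ·) (smul_left_injective F (hv τ h) hdir)
  rw [Set.ncard_prod, Set.ncard_prod] at hpairs
  exact Nat.le_of_mul_le_mul_right hpairs ((Set.ncard_pos).mpr ⟨1, one_ne_zero⟩)

theorem eq_top_of_natCard_le_mul_ncard_transvectionDirections [Finite F] (hF : 3 ≤ Nat.card F)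
    {H : Subgroup (symplecticGroup l F)}
    (hcard : Nat.card (l ⊕ l → F) ≤ Nat.card F * (transvectionDirections H).ncard) : H = ⊤ := by
  have hdir : transvectionDirections H = {0}ᶜ :=
    (isHyperbolicallyClosed_transvectionDirections H).eq_compl_zero_of_natCard_le
      symplecticForm_isAlt symplecticForm_separatingLeft hF hcard
  refine eq_top_of_forall_symplecticTransvection_mem fun v a => ?_
  rcases eq_or_ne v 0 with rfl | hv
  · exact symplecticTransvection_zero_left (l := l) a ▸ one_mem H
  · exact (hdir.ge hv).2 a

theorem symplecticTransvection_mem_of_mem {p : ℕ} [Fact p.Prime]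
    {H : Subgroup (symplecticGroup l (ZMod p))} {v : l ⊕ l → ZMod p} {a : ZMod p} (ha : a ≠ 0)
    (h : symplecticTransvection v a ∈ H) (b : ZMod p) : symplecticTransvection v b ∈ H := by
  have hpow := pow_mem h (b * a⁻¹).val
  rwa [← symplecticTransvection_natCast_mul, ZMod.natCast_zmod_val,
    inv_mul_cancel_right₀ ha] at hpow

end TransvectionDirections

theorem lemma2p2_general [Finite F] (hF : 3 ≤ Nat.card F) (H : Subgroup (symplecticGroup l F))
    (hfull : ∀ v a, a ≠ 0 → symplecticTransvection v a ∈ H → ∀ b, symplecticTransvection v b ∈ H)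
    (hH : Nat.card F ^ (2 * Fintype.card l - 1) ≤
      {τ : symplecticGroup l F | τ ∈ H ∧ τ.1.IsNontrivialTransvection}.ncard) :
    H = ⊤ := by
  refine eq_top_of_natCard_le_mul_ncard_transvectionDirections hF ?_
  calc Nat.card (l ⊕ l → F) = Nat.card F ^ (2 * Fintype.card l) := by
        rw [Nat.card_fun, Nat.card_sum, Nat.card_eq_fintype_card (α := l), two_mul]
    _ ≤ Nat.card F ^ (2 * Fintype.card l - 1 + 1) :=
        Nat.pow_le_pow_right Nat.card_pos (by lia)
    _ = Nat.card F * Nat.card F ^ (2 * Fintype.card l - 1) := pow_succ' _ _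
    _ ≤ Nat.card F * (transvectionDirections H).ncard :=
        Nat.mul_le_mul_left _
          (hH.trans (ncard_transvections_le_ncard_transvectionDirections hfull))

end SymplecticGroup

theorem lemma2p2 (g : ℕ) (hg : 1 ≤ g) (ℓ : ℕ) [Fact ℓ.Prime] (hℓ : 3 ≤ ℓ)
    (H : Subgroup (Matrix.symplecticGroup (Fin g) (ZMod ℓ)))
    (hH : ℓ ^ (2 * g - 1) ≤
      Set.ncard {τ : Matrix.symplecticGroup (Fin g) (ZMod ℓ) |
        τ ∈ H ∧ (τ : Matrix (Fin g ⊕ Fin g) (Fin g ⊕ Fin g) (ZMod ℓ)).IsNontrivialTransvection}) :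
    H = ⊤ :=
  lemma2p2_general (by rwa [Nat.card_zmod]) H
    (fun _ _ ha h => symplecticTransvection_mem_of_mem ha h) (by simpa using hH)
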